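/- All spaces are real. For a normed space $X$ with closed unit ball $B_X$ and unit sphere $S_X$, a slice of $B_X$ is a set $S(x^*,\varepsilon)=\{x\in B_X : x^*(x)>1-\varepsilon\}$ with $x^*\in S_{X^*}$ and $\varepsilon>0$. The space $X$ is - MLUR (midpoint locally uniformly rotund) if for every $x\in S_X$ and every sequence $(x_n)$ in $X$, $\|x\pm x_n\|\to 1$ implies $\|x_n\|\to 0$; - said to have the D2P (diameter 2 property) if every non-empty relatively weakly open subset of $B_X$ has diameter $2$; - said to have the LD2P+ if for every $x^*\in S_{X^*}$, all $\varepsilon,\delta>0$ and every $x\in S(x^*,\varepsilon)\cap S_X$ there is $y\in S(x^*,\varepsilon)$ with $\|x-y\|>2-\delta$. For a base $D=(D_n)_{n\ge1}$ of non-empty open subsets of $[0,1]$ let $X_D$ be the space $C[0,1]$ of real-valued continuous functions with the norm $$\|x\|_D=\Big(\sum_{n=1}^\infty 2^{-n}\sup_{d\in D_n}|x(d)|^2\Big)^{1/2}.$$ Let $(\varepsilon_n)_{n\ge1}$ be a strictly decreasing sequence of positive real numbers converging to $0$. For $n\ge1$ let $l\ge1$ and $0\le k<2^l$ be the integers with $n+1=2^l+k$,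 and let $$D_{1,n}=[0,1]\cap\Big(\frac{k}{2^{l}}-\varepsilon_n,\ \frac{k+1}{2^{l}}+\varepsilon_n\Big);$$ this interval is said to be of level $l$, so that level $l$ consists of $2^l$ consecutive intervals. For $i\ge1$ let $D_i=(D_{i,n})_{n\ge1}$ be the base of $[0,1]$ formed by the intervals of the levels $l\ge i$, in the same order and re-indexed from $1$, that is, $D_{i,n}=D_{1,\,n+2^i-2}$. **Theorem.** The $\ell_2$-sum $\ell_2\text{-}\bigoplus_{i=1}^\infty X_{D_i}$ is MLUR, has the D2P and has the LD2P+. Moreover, for every $r>0$ there are finitely many slices $S_1,\dots,S_m$ of its unit ball and $c_1,\dots,c_m\ge0$ with $\sum_j c_j=1$ such that the set $\sum_{j=1}^m c_jS_j=\{\sum_j c_jx_j : x_j\in S_j\}$ has diameter less than $r$. -/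

import Mathlib

open Set Filter Topology

/-! ### Geometry of the unit ball -/

/-- The slice `S(f, ε) = {x ∈ B_X : f x > 1 - ε}` of the closed unit ball (used for `‖f‖ = 1`
and `ε > 0`). -/
def ballSlice {X : Type*} [NormedAddCommGroup X] [NormedSpace ℝ X]
    (f : StrongDual ℝ X) (ε : ℝ) : Set X :=
  {x | x ∈ Metric.closedBall (0 : X) 1 ∧ 1 - ε < f x}

/-- Midpoint local uniform rotundity: every point of the unit sphere is strongly extreme. -/
def IsMLUR (X : Type*) [NormedAddCommGroup X] : Prop :=
  ∀ x : X, ‖x‖ = 1 → ∀ u : ℕ → X,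
    Tendsto (fun n => ‖x + u n‖) atTop (𝓝 1) → Tendsto (fun n => ‖x - u n‖) atTop (𝓝 1) →
      Tendsto u atTop (𝓝 0)

/-- The diameter 2 property: every non-empty relatively weakly open subset of the closed unit
ball has diameter 2. -/
def HasD2P (X : Type*) [NormedAddCommGroup X] [NormedSpace ℝ X] : Prop :=
  ∀ U : Set (WeakSpace ℝ X), IsOpen U →
    (Metric.closedBall (0 : X) 1 ∩ toWeakSpace ℝ X ⁻¹' U).Nonempty →
      Metric.diam (Metric.closedBall (0 : X) 1 ∩ toWeakSpace ℝ X ⁻¹' U) = 2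

/-- The local diameter 2 property +. -/
def HasLD2PPlus (X : Type*) [NormedAddCommGroup X] [NormedSpace ℝ X] : Prop :=
  ∀ f : StrongDual ℝ X, ‖f‖ = 1 → ∀ ε : ℝ, 0 < ε → ∀ δ : ℝ, 0 < δ →
    ∀ x ∈ ballSlice f ε, ‖x‖ = 1 → ∃ y ∈ ballSlice f ε, 2 - δ < ‖x - y‖

/-- `C` is a finite convex combination `∑ j, c j • S(f j, ε j)` (a Minkowski sum) of slices of
the closed unit ball. -/
def IsConvexCombOfSlices {X : Type*} [NormedAddCommGroup X] [NormedSpace ℝ X]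
    (C : Set X) : Prop :=
  ∃ (m : ℕ) (c : Fin m → ℝ) (f : Fin m → StrongDual ℝ X) (ε : Fin m → ℝ),
    (∀ j, 0 ≤ c j) ∧ ∑ j, c j = 1 ∧ (∀ j, ‖f j‖ = 1) ∧ (∀ j, 0 < ε j) ∧
      C = {z | ∃ x : Fin m → X, (∀ j, x j ∈ ballSlice (f j) (ε j)) ∧ z = ∑ j, c j • x j}

/-! ### The space `X_D` -/

/-- A countable base `(D_n)` of non-empty open sets of the unit interval, indexed from `0`. -/
structure NbhdBase where
  sets : ℕ → Set unitInterval
  nonempty : ∀ n, (sets n).Nonempty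
  isBasis : TopologicalSpace.IsTopologicalBasis (Set.range sets)

/-- The seminorm `sup_{d ∈ A} |x d|` on `C[0,1]`. -/
noncomputable def supOn (A : Set unitInterval) (x : C(unitInterval, ℝ)) : ℝ :=
  ⨆ d : A, |x d|

/-- The norm `(∑_{n ≥ 1} 2⁻ⁿ ‖x‖_n²)^{1/2}` on `C[0,1]`; as the base is indexed from `0`,
its `n`-th member has the weight `2^{-(n+1)}`. -/
noncomputable def dNorm (D : NbhdBase) (x : C(unitInterval, ℝ)) : ℝ :=
  Real.sqrt (∑' n : ℕ, (1 / 2 : ℝ) ^ (n + 1) * supOn (D.sets n) x ^ 2)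

theorem supOn_bdd (A : Set unitInterval) (x : C(unitInterval, ℝ)) :
    BddAbove (Set.range fun d : A => |x d|) :=
  ⟨‖x‖, by rintro _ ⟨d, rfl⟩; exact x.norm_coe_le_norm d⟩

theorem le_supOn {A : Set unitInterval} (x : C(unitInterval, ℝ)) {t : unitInterval}
    (ht : t ∈ A) : |x t| ≤ supOn A x :=
  le_ciSup (supOn_bdd A x) ⟨t, ht⟩

theorem supOn_nonneg (A : Set unitInterval) (x : C(unitInterval, ℝ)) : 0 ≤ supOn A x :=
  Real.iSup_nonneg fun _ => abs_nonneg _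

theorem supOn_le_norm (A : Set unitInterval) (x : C(unitInterval, ℝ)) : supOn A x ≤ ‖x‖ :=
  Real.iSup_le (fun d => x.norm_coe_le_norm d) (norm_nonneg x)

theorem supOn_add_le (A : Set unitInterval) (x y : C(unitInterval, ℝ)) :
    supOn A (x + y) ≤ supOn A x + supOn A y :=
  Real.iSup_le (fun d => (abs_add_le (x d) (y d)).trans
    (add_le_add (le_supOn x d.2) (le_supOn y d.2)))
    (add_nonneg (supOn_nonneg A x) (supOn_nonneg A y))

theorem supOn_smul (A : Set unitInterval) (c : ℝ) (x : C(unitInterval, ℝ)) :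
    supOn A (c • x) = |c| * supOn A x := by
  unfold supOn
  rw [Real.mul_iSup_of_nonneg (abs_nonneg c)]
  simp [abs_mul]

theorem dNorm_summable (D : NbhdBase) (x : C(unitInterval, ℝ)) :
    Summable fun n : ℕ => (1 / 2 : ℝ) ^ (n + 1) * supOn (D.sets n) x ^ 2 := by
  have h : Summable fun n : ℕ => (1 / 2 : ℝ) ^ (n + 1) * ‖x‖ ^ 2 :=
    ((summable_nat_add_iff 1).2 summable_geometric_two).mul_right _
  refine Summable.of_nonneg_of_le (fun n => by positivity) (fun n => ?_) h
  have := supOn_le_norm (D.sets n) x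
  have h0 := supOn_nonneg (D.sets n) x
  gcongr

theorem dNorm_smul (D : NbhdBase) (c : ℝ) (x : C(unitInterval, ℝ)) :
    dNorm D (c • x) = |c| * dNorm D x := by
  unfold dNorm
  have : ∀ n : ℕ, (1 / 2 : ℝ) ^ (n + 1) * supOn (D.sets n) (c • x) ^ 2
      = |c| ^ 2 * ((1 / 2 : ℝ) ^ (n + 1) * supOn (D.sets n) x ^ 2) := by
    intro n; rw [supOn_smul]; ring
  simp_rw [this]
  rw [tsum_mul_left, Real.sqrt_mul (by positivity), Real.sqrt_sq (abs_nonneg c)]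

theorem dNorm_zero (D : NbhdBase) : dNorm D 0 = 0 := by
  have h := dNorm_smul D 0 0
  simpa using h

theorem dNorm_neg (D : NbhdBase) (x : C(unitInterval, ℝ)) : dNorm D (-x) = dNorm D x := by
  have h := dNorm_smul D (-1) x
  rwa [abs_neg, abs_one, one_mul, neg_one_smul] at h

theorem dNorm_add_le (D : NbhdBase) (x y : C(unitInterval, ℝ)) :
    dNorm D (x + y) ≤ dNorm D x + dNorm D y := by
  have key : ∀ z : C(unitInterval, ℝ), ∀ n : ℕ,
      (Real.sqrt ((1 / 2 : ℝ) ^ (n + 1)) * supOn (D.sets n) z) ^ (2 : ℝ)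
        = (1 / 2 : ℝ) ^ (n + 1) * supOn (D.sets n) z ^ 2 := by
    intro z n
    rw [Real.rpow_two, mul_pow, Real.sq_sqrt (by positivity)]
  have hs : ∀ z : C(unitInterval, ℝ), Summable fun n : ℕ =>
      (Real.sqrt ((1 / 2 : ℝ) ^ (n + 1)) * supOn (D.sets n) z) ^ (2 : ℝ) := by
    intro z; simp_rw [key z]; exact dNorm_summable D z
  have hn : ∀ z : C(unitInterval, ℝ), ∀ n : ℕ,
      0 ≤ Real.sqrt ((1 / 2 : ℝ) ^ (n + 1)) * supOn (D.sets n) z := fun z n =>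
    mul_nonneg (Real.sqrt_nonneg _) (supOn_nonneg _ _)
  have hM := Real.Lp_add_le_tsum_of_nonneg (p := 2) (by norm_num) (hn x) (hn y) (hs x) (hs y)
  have h2 := hM.2
  simp_rw [key] at h2
  rw [← Real.sqrt_eq_rpow, ← Real.sqrt_eq_rpow, ← Real.sqrt_eq_rpow] at h2
  refine le_trans (Real.sqrt_le_sqrt ?_) h2
  refine (dNorm_summable D (x + y)).tsum_le_tsum (fun n => ?_) hM.1
  rw [← key (x + y) n, ← mul_add]
  exact Real.rpow_le_rpow (hn _ n)
    (mul_le_mul_of_nonneg_left (supOn_add_le _ _ _) (Real.sqrt_nonneg _)) (by norm_num)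

theorem dNorm_eq_zero (D : NbhdBase) (x : C(unitInterval, ℝ)) (h : dNorm D x = 0) : x = 0 := by
  have hnn : ∀ n : ℕ, 0 ≤ (1 / 2 : ℝ) ^ (n + 1) * supOn (D.sets n) x ^ 2 := fun n => by
    positivity
  have h0 := (Real.sqrt_eq_zero (tsum_nonneg hnn)).1 h
  have h1 := (hasSum_zero_iff_of_nonneg hnn).1 (h0 ▸ (dNorm_summable D x).hasSum)
  ext t
  obtain ⟨_, ⟨n, rfl⟩, ht, -⟩ := D.isBasis.exists_subset_of_mem_open (mem_univ t) isOpen_univ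
  have h2 : supOn (D.sets n) x = 0 := by
    have := congrFun h1 n
    simpa using this
  have h3 := le_supOn x ht
  rw [h2] at h3
  simpa using h3

/-- The space `X_D`: real-valued continuous functions on `[0,1]` with the norm `dNorm D`. -/
def XSpace (_D : NbhdBase) : Type := C(unitInterval, ℝ)

noncomputable instance XSpace.instAddCommGroup (D : NbhdBase) : AddCommGroup (XSpace D) :=
  inferInstanceAs (AddCommGroup C(unitInterval, ℝ))

noncomputable instance XSpace.instModule (D : NbhdBase) : Module ℝ (XSpace D) :=
  inferInstanceAs (Module ℝ C(unitInterval, ℝ))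

noncomputable instance XSpace.instNormedAddCommGroup (D : NbhdBase) :
    NormedAddCommGroup (XSpace D) :=
  AddGroupNorm.toNormedAddCommGroup
    { toFun := fun x => dNorm D x
      map_zero' := dNorm_zero D
      add_le' := fun x y => dNorm_add_le D x y
      neg' := fun x => dNorm_neg D x
      eq_zero_of_map_eq_zero' := fun x hx => dNorm_eq_zero D x hx }

theorem XSpace.norm_def (D : NbhdBase) (x : XSpace D) : ‖x‖ = dNorm D x := rfl

noncomputable instance XSpace.instNormedSpace (D : NbhdBase) : NormedSpace ℝ (XSpace D) where
  norm_smul_le c x := (dNorm_smul D c x).le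

/-! ### The dyadic bases -/

/-- The sequence of all enlarged dyadic intervals, in the order of the levels `1, 2, 3, …` and
from left to right within a level, indexed from `0`. The level `l ≥ 1` consists of the `2 ^ l`
indices `n` with `2 ^ l ≤ n + 2 < 2 ^ (l + 1)`, and for `k = n + 2 - 2 ^ l` the `n`-th set is
`(k / 2 ^ l - ε n, (k + 1) / 2 ^ l + ε n) ∩ [0,1]`. -/
def dyadicNbhd (ε : ℕ → ℝ) (n : ℕ) : Set unitInterval :=
  {t | (((n + 2 - 2 ^ Nat.log 2 (n + 2) : ℕ) : ℝ)) / 2 ^ Nat.log 2 (n + 2) - ε n < (t : ℝ) ∧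
    (t : ℝ) < (((n + 2 - 2 ^ Nat.log 2 (n + 2) : ℕ) : ℝ) + 1) / 2 ^ Nat.log 2 (n + 2) + ε n}

theorem mem_dyadicNbhd_iff (ε : ℕ → ℝ) {l k : ℕ} (hl : 1 ≤ l) (hk : k < 2 ^ l)
    (t : unitInterval) :
    t ∈ dyadicNbhd ε (2 ^ l + k - 2) ↔
      (k : ℝ) / 2 ^ l - ε (2 ^ l + k - 2) < (t : ℝ) ∧
        (t : ℝ) < ((k : ℝ) + 1) / 2 ^ l + ε (2 ^ l + k - 2) := by
  have h2 : 2 ≤ 2 ^ l := by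
    calc 2 = 2 ^ 1 := rfl
      _ ≤ 2 ^ l := Nat.pow_le_pow_right (by norm_num) hl
  have e : 2 ^ l + k - 2 + 2 = 2 ^ l + k := by omega
  have hlog : Nat.log 2 (2 ^ l + k) = l := by
    refine Nat.log_eq_of_pow_le_of_lt_pow (by omega) ?_
    rw [pow_succ]; omega
  unfold dyadicNbhd
  rw [mem_ofPred_eq, e, hlog, Nat.add_sub_cancel_left]

theorem dyadicNbhd_isOpen (ε : ℕ → ℝ) (n : ℕ) : IsOpen (dyadicNbhd ε n) :=
  (isOpen_lt continuous_const continuous_subtype_val).inter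
    (isOpen_lt continuous_subtype_val continuous_const)

theorem dyadicNbhd_nonempty (ε : ℕ → ℝ) (hpos : ∀ n, 0 < ε n) (n : ℕ) :
    (dyadicNbhd ε n).Nonempty := by
  have h1 : 2 ^ Nat.log 2 (n + 2) ≤ n + 2 := Nat.pow_log_le_self 2 (by omega)
  have h2 : n + 2 < 2 ^ (Nat.log 2 (n + 2) + 1) := Nat.lt_pow_succ_log_self (by norm_num) _
  rw [pow_succ] at h2
  have h3 : n + 2 - 2 ^ Nat.log 2 (n + 2) ≤ 2 ^ Nat.log 2 (n + 2) := by omega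
  have h3' : ((n + 2 - 2 ^ Nat.log 2 (n + 2) : ℕ) : ℝ) ≤ 2 ^ Nat.log 2 (n + 2) := by
    exact_mod_cast h3
  have hp : (0 : ℝ) < 2 ^ Nat.log 2 (n + 2) := by positivity
  have h4 := hpos n
  refine ⟨⟨((n + 2 - 2 ^ Nat.log 2 (n + 2) : ℕ) : ℝ) / 2 ^ Nat.log 2 (n + 2), by positivity,
    (div_le_one hp).2 h3'⟩, ?_, ?_⟩
  · simp only; linarith
  · have h5 : ((n + 2 - 2 ^ Nat.log 2 (n + 2) : ℕ) : ℝ) / 2 ^ Nat.log 2 (n + 2)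
        ≤ (((n + 2 - 2 ^ Nat.log 2 (n + 2) : ℕ) : ℝ) + 1) / 2 ^ Nat.log 2 (n + 2) := by
      gcongr; linarith
    simp only; linarith

theorem exists_dyadic_cell (t : unitInterval) (l : ℕ) :
    ∃ k : ℕ, k < 2 ^ l ∧ (k : ℝ) / 2 ^ l ≤ t ∧ (t : ℝ) ≤ ((k : ℝ) + 1) / 2 ^ l := by
  have hp : (0 : ℝ) < 2 ^ l := by positivity
  have hpn : 0 < 2 ^ l := by positivity
  have ht0 := t.2.1
  have ht1 := t.2.2
  by_cases h : (t : ℝ) = 0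
  · refine ⟨0, hpn, ?_, ?_⟩
    · simp [h]
    · rw [h]; positivity
  · have htp : (0 : ℝ) < t * 2 ^ l := mul_pos (lt_of_le_of_ne ht0 (Ne.symm h)) hp
    have hc : 0 < ⌈(t : ℝ) * 2 ^ l⌉₊ := Nat.ceil_pos.2 htp
    obtain ⟨k, hk⟩ : ∃ k, ⌈(t : ℝ) * 2 ^ l⌉₊ = k + 1 := ⟨_, (Nat.succ_pred_eq_of_pos hc).symm⟩
    have hle : ⌈(t : ℝ) * 2 ^ l⌉₊ ≤ 2 ^ l := by
      refine Nat.ceil_le.2 ?_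
      push_cast
      nlinarith
    have h1 : (t : ℝ) * 2 ^ l ≤ (k : ℝ) + 1 := by
      have := Nat.le_ceil ((t : ℝ) * 2 ^ l)
      rw [hk] at this
      exact_mod_cast this
    have h2 : (k : ℝ) < t * 2 ^ l := Nat.lt_ceil.1 (by omega)
    exact ⟨k, by omega, (div_le_iff₀ hp).2 h2.le, (le_div_iff₀ hp).2 h1⟩

theorem dyadicNbhd_isBasis (ε : ℕ → ℝ) (hpos : ∀ n, 0 < ε n) (hlim : Tendsto ε atTop (𝓝 0))
    (i : ℕ) : TopologicalSpace.IsTopologicalBasis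
      (Set.range fun n : ℕ => dyadicNbhd ε (2 ^ (i + 1) - 2 + n)) := by
  refine TopologicalSpace.isTopologicalBasis_of_isOpen_of_nhds ?_ ?_
  · rintro _ ⟨n, rfl⟩
    exact dyadicNbhd_isOpen _ _
  · intro t U ht hU
    obtain ⟨δ, hδ, hball⟩ := Metric.isOpen_iff.1 hU t ht
    obtain ⟨N, hN⟩ := eventually_atTop.1 (hlim.eventually (gt_mem_nhds (show 0 < δ / 4 by linarith)))
    obtain ⟨M, hM⟩ := exists_pow_lt_of_lt_one (show 0 < δ / 2 by linarith)
      (show (1 / 2 : ℝ) < 1 by norm_num)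
    obtain ⟨l, hlM, hlN, hli⟩ : ∃ l, M ≤ l ∧ N + 1 ≤ l ∧ i + 1 ≤ l :=
      ⟨M + (N + 1) + (i + 1), by omega, by omega, by omega⟩
    obtain ⟨k, hk, hk1, hk2⟩ := exists_dyadic_cell t l
    have hl2 : l + 1 ≤ 2 ^ l := Nat.lt_two_pow_self
    have hi2 : 2 ^ (i + 1) ≤ 2 ^ l := Nat.pow_le_pow_right (by norm_num) hli
    have hi3 : 2 ≤ 2 ^ (i + 1) := by
      calc 2 = 2 ^ 1 := rfl
        _ ≤ 2 ^ (i + 1) := Nat.pow_le_pow_right (by norm_num) (by omega)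
    have hεp := hpos (2 ^ l + k - 2)
    refine ⟨_, ⟨2 ^ l + k - 2 ^ (i + 1), rfl⟩, ?_, ?_⟩
    all_goals
      have e : 2 ^ (i + 1) - 2 + (2 ^ l + k - 2 ^ (i + 1)) = 2 ^ l + k - 2 := by omega
      simp only [e]
    · rw [mem_dyadicNbhd_iff ε (by omega) hk]
      constructor <;> linarith
    · intro s hs
      rw [mem_dyadicNbhd_iff ε (by omega) hk] at hs
      apply hball
      rw [Metric.mem_ball, Subtype.dist_eq, Real.dist_eq, abs_lt]
      have hε := hN (2 ^ l + k - 2) (by omega)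
      have hw : (1 / 2 : ℝ) ^ l < δ / 2 :=
        lt_of_le_of_lt (pow_le_pow_of_le_one (by norm_num) (by norm_num) hlM) hM
      have hsplit : ((k : ℝ) + 1) / 2 ^ l = (k : ℝ) / 2 ^ l + (1 / 2 : ℝ) ^ l := by
        rw [add_div, one_div_pow]
      obtain ⟨hs1, hs2⟩ := hs
      rw [hsplit] at hs2 hk2
      constructor <;> linarith

/-- The base consisting of the enlarged dyadic intervals of all levels `≥ i + 1`, in their order
and re-indexed from the beginning (the levels below `i + 1` hold `2 ^ (i + 1) - 2` intervals).
For `i = 0, 1, 2, …` these are the bases `D_1, D_2, D_3, …`. -/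
def dyadicBase (ε : ℕ → ℝ) (hpos : ∀ n, 0 < ε n) (hlim : Tendsto ε atTop (𝓝 0)) (i : ℕ) :
    NbhdBase where
  sets n := dyadicNbhd ε (2 ^ (i + 1) - 2 + n)
  nonempty _ := dyadicNbhd_nonempty ε hpos _
  isBasis := dyadicNbhd_isBasis ε hpos hlim i

/-- The `ℓ_2`-sum of the spaces `X_{D_i}`, `i = 1, 2, 3, …`. -/
abbrev L2SumXSpace (ε : ℕ → ℝ) (hpos : ∀ n, 0 < ε n) (hlim : Tendsto ε atTop (𝓝 0)) : Type :=
  lp (fun i : ℕ => XSpace (dyadicBase ε hpos hlim i)) 2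

/-! ### Sums of squares -/

/-! MLUR. Both `dNorm` and the norm of an `ℓ_2`-sum are square sums of seminorms. If `‖x ± u_k‖ →
‖x‖`, the triangle inequality in each term together with the convexity of the square
(`sum_sq_sub_le`) makes every single seminorm of `x ± u_k` converge to that of `x`. In `X_D` this
forces `u_k → 0` uniformly: on a basic set where `|x|` is nearly equal to its supremum, one of `|x +
u_k|`, `|x - u_k|` equals `|x| + |u_k|`. In the sum, domination turns coordinatewise convergence
into norm convergence (`HasStrongMidpoints.lp_two`).

Diameter properties. Given `x` of norm one, multiply all its coordinates by `1 - 2φ_k` with bumps `0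
≤ φ_k ≤ 1`. For a fixed frequency `M` the bumps `sinBump M k` are disjointly supported, so `φ_k x →
0` weakly. For `M` large each of them attains the value 1 in any prescribed open set, so `‖φ_k x‖`
is close to 1 uniformly in `k`. Hence `(1 - 2φ_k) x` stays in the ball, tends weakly to `x`, and
lies at distance almost 2 from it (`hasFarWeakApprox_lp`). LD2P+ follows at once; the D2P follows
because weakly open sets meeting the ball meet the sphere.

Small combinations of slices. A thin slice at a normalized point evaluation of the first coordinate
contains only functions concentrated near that point, since cutting `x` off around the point keeps
the value of the functional (`exists_ballSlice_small`). For `m` distinct points such functions are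
almost disjoint, so their squared norms essentially add up, and their average has norm of order `1 /
√m`. -/

theorem lp_two_hasSum_sq {α : Type*} {E : α → Type*} [∀ i, NormedAddCommGroup (E i)]
    (x : lp E 2) : HasSum (fun i => ‖x i‖ ^ 2) (‖x‖ ^ 2) := by
  have h := lp.hasSum_norm (p := 2) (by norm_num) x
  simpa [ENNReal.toReal_ofNat, Real.rpow_two] using h

theorem memℓp_two_of_summable_sq {α : Type*} {E : α → Type*} [∀ i, NormedAddCommGroup (E i)]
    {x : ∀ i, E i} (h : Summable fun i => ‖x i‖ ^ 2) : Memℓp x 2 :=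
  memℓp_gen (by simpa [ENNReal.toReal_ofNat, Real.rpow_two] using h)

theorem dNorm_nonneg (D : NbhdBase) (x : C(unitInterval, ℝ)) : 0 ≤ dNorm D x :=
  Real.sqrt_nonneg _

theorem dNorm_hasSum_sq (D : NbhdBase) (x : C(unitInterval, ℝ)) :
    HasSum (fun n : ℕ => (1 / 2 : ℝ) ^ (n + 1) * supOn (D.sets n) x ^ 2) (dNorm D x ^ 2) := by
  rw [dNorm, Real.sq_sqrt (tsum_nonneg fun n => by positivity)]
  exact (dNorm_summable D x).hasSum

theorem hasSum_half_pow_succ : HasSum (fun n : ℕ => (1 / 2 : ℝ) ^ (n + 1)) 1 := by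
  have h := hasSum_geometric_two.mul_left (1 / 2 : ℝ)
  simpa [pow_succ, mul_comm] using h

/-- If `s ≤ (p + q) / 2` then the weighted quadratic distance of `p` to `s` is controlled by the
defect of `s` in the weighted sums of squares. -/
theorem sum_sq_sub_le {w p q s : ℕ → ℝ} {P Q S : ℝ} (hw : ∀ n, 0 ≤ w n) (hs : ∀ n, 0 ≤ s n)
    (hpq : ∀ n, 2 * s n ≤ p n + q n)
    (hP : HasSum (fun n => w n * p n ^ 2) P) (hQ : HasSum (fun n => w n * q n ^ 2) Q)
    (hS : HasSum (fun n => w n * s n ^ 2) S) :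
    (Summable fun n => w n * (p n - s n) ^ 2) ∧
      ∑' n, w n * (p n - s n) ^ 2 ≤ P + Q - 2 * S := by
  have hsum := (hP.add hQ).sub (hS.mul_left 2)
  have hle : ∀ n, w n * (p n - s n) ^ 2 ≤
      w n * p n ^ 2 + w n * q n ^ 2 - 2 * (w n * s n ^ 2) := by
    intro n
    -- Here `p² + q² - 2s² = (p - s)² + (q - s)² + 2s(p + q - 2s)`, and the last two terms are
    -- nonnegative.
    have h : (p n - s n) ^ 2 ≤ p n ^ 2 + q n ^ 2 - 2 * s n ^ 2 := by
      nlinarith [hs n, hpq n, sq_nonneg (q n - s n), mul_nonneg (hs n) (sub_nonneg.2 (hpq n))]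
    nlinarith [mul_le_mul_of_nonneg_left h (hw n)]
  have hsm : Summable fun n => w n * (p n - s n) ^ 2 :=
    Summable.of_nonneg_of_le (fun n => mul_nonneg (hw n) (sq_nonneg _)) hle hsum.summable
  exact ⟨hsm, hasSum_le hle hsm.hasSum hsum⟩

theorem tendsto_sum_sq_sub {w s : ℕ → ℝ} {p q : ℕ → ℕ → ℝ} {P Q : ℕ → ℝ} {N : ℝ}
    (hw : ∀ n, 0 ≤ w n) (hs : ∀ n, 0 ≤ s n) (hpq : ∀ k n, 2 * s n ≤ p k n + q k n)
    (hP : ∀ k, HasSum (fun n => w n * p k n ^ 2) (P k ^ 2))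
    (hQ : ∀ k, HasSum (fun n => w n * q k n ^ 2) (Q k ^ 2))
    (hS : HasSum (fun n => w n * s n ^ 2) (N ^ 2))
    (hPN : Tendsto P atTop (𝓝 N)) (hQN : Tendsto Q atTop (𝓝 N)) :
    Tendsto (fun k => ∑' n, w n * (p k n - s n) ^ 2) atTop (𝓝 0) := by
  have h0 : Tendsto (fun k => P k ^ 2 + Q k ^ 2 - 2 * N ^ 2) atTop (𝓝 0) := by
    have h := ((hPN.pow 2).add (hQN.pow 2)).sub_const (2 * N ^ 2)
    rwa [← two_mul, sub_self] at h
  exact squeeze_zero (fun k => tsum_nonneg fun n => mul_nonneg (hw n) (sq_nonneg _))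
    (fun k => (sum_sq_sub_le hw hs (hpq k) (hP k) (hQ k) hS).2) h0

theorem tendsto_of_sum_sq_sub {w s : ℕ → ℝ} {p q : ℕ → ℕ → ℝ} {P Q : ℕ → ℝ} {N : ℝ}
    (hw : ∀ n, 0 < w n) (hs : ∀ n, 0 ≤ s n) (hpq : ∀ k n, 2 * s n ≤ p k n + q k n)
    (hP : ∀ k, HasSum (fun n => w n * p k n ^ 2) (P k ^ 2))
    (hQ : ∀ k, HasSum (fun n => w n * q k n ^ 2) (Q k ^ 2))
    (hS : HasSum (fun n => w n * s n ^ 2) (N ^ 2))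
    (hPN : Tendsto P atTop (𝓝 N)) (hQN : Tendsto Q atTop (𝓝 N)) (n : ℕ) :
    Tendsto (fun k => p k n) atTop (𝓝 (s n)) := by
  have hw' := fun n => (hw n).le
  have h := tendsto_sum_sq_sub hw' hs hpq hP hQ hS hPN hQN
  have h1 : Tendsto (fun k => w n * (p k n - s n) ^ 2) atTop (𝓝 0) :=
    squeeze_zero (fun k => mul_nonneg (hw' n) (sq_nonneg _))
      (fun k => (sum_sq_sub_le hw' hs (hpq k) (hP k) (hQ k) hS).1.le_tsum n
        fun j _ => mul_nonneg (hw' j) (sq_nonneg _)) h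
  have h2 : Tendsto (fun k => (p k n - s n) ^ 2) atTop (𝓝 0) := by
    have := h1.const_mul (w n)⁻¹
    simpa [← mul_assoc, (hw n).ne'] using this
  have h3 : Tendsto (fun k => |p k n - s n|) atTop (𝓝 0) := by
    have := h2.sqrt
    simpa [Real.sqrt_sq_eq_abs] using this
  exact tendsto_sub_nhds_zero_iff.1 ((tendsto_zero_iff_abs_tendsto_zero _).2 h3)

theorem two_mul_norm_le_norm_add_add_norm_sub {E : Type*} [NormedAddCommGroup E]
    [NormedSpace ℝ E] (x u : E) : 2 * ‖x‖ ≤ ‖x + u‖ + ‖x - u‖ := by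
  have h := norm_add_le (x + u) (x - u)
  have e : x + u + (x - u) = (2 : ℝ) • x := by rw [two_smul]; abel
  rwa [e, norm_smul, Real.norm_of_nonneg two_pos.le] at h

/-! ### Estimates for the norm of `X_D` -/

theorem dNorm_le_of_forall_abs_le (D : NbhdBase) {x : C(unitInterval, ℝ)} {c : ℝ} (hc : 0 ≤ c)
    (h : ∀ s, |x s| ≤ c) : dNorm D x ≤ c := by
  refine le_of_sq_le_sq ?_ hc
  have h1 := hasSum_half_pow_succ.mul_right (c ^ 2)
  rw [one_mul] at h1
  refine hasSum_le (fun n => ?_) (dNorm_hasSum_sq D x) h1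
  have h2 : supOn (D.sets n) x ≤ c := Real.iSup_le (fun d => h d) hc
  have h0 := supOn_nonneg (D.sets n) x
  gcongr

theorem supOn_mono_abs (A : Set unitInterval) {x y : C(unitInterval, ℝ)}
    (h : ∀ s ∈ A, |x s| ≤ |y s|) : supOn A x ≤ supOn A y :=
  Real.iSup_le (fun d => (h d d.2).trans (le_supOn y d.2)) (supOn_nonneg A y)

theorem dNorm_mono_abs (D : NbhdBase) {x y : C(unitInterval, ℝ)} (h : ∀ s, |x s| ≤ |y s|) :
    dNorm D x ≤ dNorm D y := by
  refine le_of_sq_le_sq ?_ (dNorm_nonneg D y)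
  refine hasSum_le (fun n => ?_) (dNorm_hasSum_sq D x) (dNorm_hasSum_sq D y)
  have h2 := supOn_mono_abs (D.sets n) fun s _ => h s
  have h0 := supOn_nonneg (D.sets n) x
  gcongr

theorem two_mul_supOn_le (A : Set unitInterval) (x u : C(unitInterval, ℝ)) :
    2 * supOn A x ≤ supOn A (x + u) + supOn A (x - u) := by
  have h := supOn_add_le A (x + u) (x - u)
  have e : x + u + (x - u) = (2 : ℝ) • x := by rw [two_smul]; abel
  rw [e, supOn_smul, abs_of_pos two_pos] at h
  exact h

theorem NbhdBase.exists_mem_subset (D : NbhdBase) {t : unitInterval} {V : Set unitInterval}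
    (hV : V ∈ 𝓝 t) : ∃ n, t ∈ D.sets n ∧ D.sets n ⊆ V := by
  obtain ⟨_, ⟨n, rfl⟩, ht, hs⟩ := D.isBasis.mem_nhds_iff.1 hV
  exact ⟨n, ht, hs⟩

theorem NbhdBase.isOpen_sets (D : NbhdBase) (n : ℕ) : IsOpen (D.sets n) :=
  D.isBasis.isOpen ⟨n, rfl⟩

/-! ### Midpoint local uniform rotundity -/

/-- Each seminorm of `x ± u_k` tends to that of `x`. Near a given point `x` is almost constant on
some basic set, which bounds `|u_k|` there; compactness of `[0,1]` makes the bound uniform. -/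
theorem dNorm_tendsto_zero_of_midpoint (D : NbhdBase) (x : C(unitInterval, ℝ))
    (u : ℕ → C(unitInterval, ℝ))
    (h1 : Tendsto (fun k => dNorm D (x + u k)) atTop (𝓝 (dNorm D x)))
    (h2 : Tendsto (fun k => dNorm D (x - u k)) atTop (𝓝 (dNorm D x))) :
    Tendsto (fun k => dNorm D (u k)) atTop (𝓝 0) := by
  have hplus : ∀ n, Tendsto (fun k => supOn (D.sets n) (x + u k)) atTop
      (𝓝 (supOn (D.sets n) x)) :=
    tendsto_of_sum_sq_sub (w := fun n => (1 / 2 : ℝ) ^ (n + 1)) (s := fun n => supOn (D.sets n) x)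
      (p := fun k n => supOn (D.sets n) (x + u k)) (q := fun k n => supOn (D.sets n) (x - u k))
      (fun n => by positivity) (fun n => supOn_nonneg _ _) (fun k n => two_mul_supOn_le _ _ _)
      (fun k => dNorm_hasSum_sq D _) (fun k => dNorm_hasSum_sq D _) (dNorm_hasSum_sq D x) h1 h2
  have hminus : ∀ n, Tendsto (fun k => supOn (D.sets n) (x - u k)) atTop
      (𝓝 (supOn (D.sets n) x)) :=
    tendsto_of_sum_sq_sub (w := fun n => (1 / 2 : ℝ) ^ (n + 1)) (s := fun n => supOn (D.sets n) x)
      (p := fun k n => supOn (D.sets n) (x - u k)) (q := fun k n => supOn (D.sets n) (x + u k))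
      (fun n => by positivity) (fun n => supOn_nonneg _ _)
      (fun k n => by rw [add_comm]; exact two_mul_supOn_le _ _ _)
      (fun k => dNorm_hasSum_sq D _) (fun k => dNorm_hasSum_sq D _) (dNorm_hasSum_sq D x) h2 h1
  have hunif : TendstoUniformly (fun k s => u k s) (fun _ : unitInterval => (0 : ℝ)) atTop := by
    rw [← tendstoLocallyUniformly_iff_tendstoUniformly_of_compactSpace,
      Metric.tendstoLocallyUniformly_iff]
    intro η hη t
    have hV : {s | |x s - x t| < η / 4} ∈ 𝓝 t := by
      refine IsOpen.mem_nhds (isOpen_lt (by fun_prop) continuous_const) ?_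
      simp only [mem_ofPred_eq, sub_self, abs_zero]; linarith
    obtain ⟨n, htn, hn⟩ := D.exists_mem_subset hV
    refine ⟨D.sets n, (D.isOpen_sets n).mem_nhds htn, ?_⟩
    have hsup : supOn (D.sets n) x ≤ |x t| + η / 4 := by
      refine Real.iSup_le (fun d => ?_) (by positivity)
      have h := hn d.2
      have h' := abs_sub_abs_le_abs_sub (x d) (x t)
      simp only [mem_ofPred_eq] at h
      linarith
    filter_upwards [(hplus n).eventually_lt_const (lt_add_of_pos_right _ (by linarith : 0 < η / 4)),
      (hminus n).eventually_lt_const (lt_add_of_pos_right _ (by linarith : 0 < η / 4))]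
      with k hk1 hk2 s hs
    have e1 := le_supOn (x + u k) hs
    have e2 := le_supOn (x - u k) hs
    have e3 := hn hs
    simp only [ContinuousMap.add_apply, ContinuousMap.sub_apply, mem_ofPred_eq] at e1 e2 e3
    rw [dist_comm, Real.dist_eq, sub_zero]
    -- For real numbers one choice of sign avoids all cancellation.
    have e4 : |x s| + |u k s| ≤ max |x s + u k s| |x s - u k s| := by
      rcases abs_cases (x s) with h | h <;> rcases abs_cases (u k s) with h' | h' <;>
        rw [h.1, h'.1, le_max_iff, le_abs, le_abs] <;> grind
    have e5 : |x t| - |x s| ≤ |x s - x t| := by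
      rw [abs_sub_comm]; exact abs_sub_abs_le_abs_sub _ _
    rcases le_max_iff.1 e4 with h | h <;> linarith
  refine Metric.tendsto_atTop'.2 fun η hη => ?_
  obtain ⟨K, hK⟩ := eventually_atTop.1 (Metric.tendstoUniformly_iff.1 hunif (η / 2) (half_pos hη))
  refine ⟨K, fun k hk => ?_⟩
  have h := dNorm_le_of_forall_abs_le D (x := u k) (half_pos hη).le fun s => by
    have := hK k hk.le s
    rw [dist_comm, Real.dist_eq, sub_zero] at this
    exact this.le
  rw [Real.dist_eq, sub_zero, abs_of_nonneg (dNorm_nonneg D _)]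
  linarith

/-- The homogeneous form of midpoint local uniform rotundity. -/
def HasStrongMidpoints (X : Type*) [NormedAddCommGroup X] : Prop :=
  ∀ (x : X) (u : ℕ → X), Tendsto (fun k => ‖x + u k‖) atTop (𝓝 ‖x‖) →
    Tendsto (fun k => ‖x - u k‖) atTop (𝓝 ‖x‖) → Tendsto (fun k => ‖u k‖) atTop (𝓝 0)

theorem XSpace.hasStrongMidpoints (D : NbhdBase) : HasStrongMidpoints (XSpace D) :=
  fun x u h1 h2 => dNorm_tendsto_zero_of_midpoint D x u h1 h2

/-- Strong midpoints pass to countable `ℓ_2`-sums. -/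
theorem HasStrongMidpoints.lp_two {E : ℕ → Type*} [∀ i, NormedAddCommGroup (E i)]
    [∀ i, NormedSpace ℝ (E i)] (hE : ∀ i, HasStrongMidpoints (E i)) : HasStrongMidpoints (lp E 2) := by
  intro x u h1 h2
  have hsq : ∀ y : lp E 2, HasSum (fun i => (1 : ℝ) * ‖y i‖ ^ 2) (‖y‖ ^ 2) := fun y => by
    simpa using lp_two_hasSum_sq y
  have hplus : ∀ i, Tendsto (fun k => ‖x i + u k i‖) atTop (𝓝 ‖x i‖) :=
    tendsto_of_sum_sq_sub (w := fun _ => 1) (s := fun i => ‖x i‖)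
      (p := fun k i => ‖x i + u k i‖) (q := fun k i => ‖x i - u k i‖)
      (fun _ => one_pos) (fun i => norm_nonneg _)
      (fun k i => two_mul_norm_le_norm_add_add_norm_sub _ _)
      (fun k => hsq (x + u k)) (fun k => hsq (x - u k)) (hsq x) h1 h2
  have hminus : ∀ i, Tendsto (fun k => ‖x i - u k i‖) atTop (𝓝 ‖x i‖) :=
    tendsto_of_sum_sq_sub (w := fun _ => 1) (s := fun i => ‖x i‖)
      (p := fun k i => ‖x i - u k i‖) (q := fun k i => ‖x i + u k i‖)
      (fun _ => one_pos) (fun i => norm_nonneg _)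
      (fun k i => by rw [add_comm]; exact two_mul_norm_le_norm_add_add_norm_sub _ _)
      (fun k => hsq (x - u k)) (fun k => hsq (x + u k)) (hsq x) h2 h1
  have hcoord : ∀ i, Tendsto (fun k => ‖u k i‖) atTop (𝓝 0) := fun i =>
    hE i (x i) (fun k => u k i) (hplus i) (hminus i)
  have htot : Tendsto (fun k => ∑' i, (1 : ℝ) * (‖x i + u k i‖ - ‖x i‖) ^ 2) atTop (𝓝 0) :=
    tendsto_sum_sq_sub (w := fun _ => 1) (s := fun i => ‖x i‖)
      (p := fun k i => ‖x i + u k i‖) (q := fun k i => ‖x i - u k i‖)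
      (fun _ => zero_le_one) (fun i => norm_nonneg _)
      (fun k i => two_mul_norm_le_norm_add_add_norm_sub _ _)
      (fun k => hsq (x + u k)) (fun k => hsq (x - u k)) (hsq x) h1 h2
  have htotsum : ∀ k, Summable fun i => (1 : ℝ) * (‖x i + u k i‖ - ‖x i‖) ^ 2 := fun k =>
    (sum_sq_sub_le (w := fun _ => 1) (s := fun i => ‖x i‖)
      (p := fun i => ‖x i + u k i‖) (q := fun i => ‖x i - u k i‖)
      (fun _ => zero_le_one) (fun i => norm_nonneg _)
      (fun i => two_mul_norm_le_norm_add_add_norm_sub _ _)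
      (hsq (x + u k)) (hsq (x - u k)) (hsq x)).1
  -- The terms `‖u k i‖²` have no dominating sequence, but their minimum with `8‖x i‖²` does. The 8
  -- comes from squaring `‖u‖ ≤ (‖x + u‖ - ‖x‖) + 2‖x‖`; the excess over the minimum is paid for by
  -- the total defect `htot`.
  have hx8 : Summable fun i => 8 * ‖x i‖ ^ 2 := (lp_two_hasSum_sq x).summable.mul_left 8
  have hmin0 : ∀ k i, 0 ≤ min (‖u k i‖ ^ 2) (8 * ‖x i‖ ^ 2) := fun k i => by positivity
  have hmin : Tendsto (fun k => ∑' i, min (‖u k i‖ ^ 2) (8 * ‖x i‖ ^ 2)) atTop (𝓝 0) := by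
    have h := tendsto_tsum_of_dominated_convergence (𝓕 := (atTop : Filter ℕ))
      (f := fun k i => min (‖u k i‖ ^ 2) (8 * ‖x i‖ ^ 2)) (g := fun _ => (0 : ℝ)) hx8
      (fun i => squeeze_zero (fun k => hmin0 k i) (fun k => min_le_left _ _)
        (by simpa using (hcoord i).pow 2))
      (Eventually.of_forall fun k i => by
        rw [Real.norm_of_nonneg (hmin0 k i)]; exact min_le_right _ _)
    simpa using h
  have hbound : ∀ k, ‖u k‖ ^ 2 ≤ ∑' i, min (‖u k i‖ ^ 2) (8 * ‖x i‖ ^ 2) +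
      2 * ∑' i, (1 : ℝ) * (‖x i + u k i‖ - ‖x i‖) ^ 2 := by
    intro k
    have hs1 : Summable fun i => min (‖u k i‖ ^ 2) (8 * ‖x i‖ ^ 2) :=
      Summable.of_nonneg_of_le (hmin0 k) (fun i => min_le_right _ _) hx8
    refine hasSum_le (fun i => ?_) (lp_two_hasSum_sq (u k))
      (hs1.hasSum.add ((htotsum k).hasSum.mul_left 2))
    have htri : ‖u k i‖ ≤ ‖x i + u k i‖ + ‖x i‖ := by
      simpa using norm_sub_le (x i + u k i) (x i)
    have h8 : ‖u k i‖ ^ 2 ≤ 8 * ‖x i‖ ^ 2 + 2 * (‖x i + u k i‖ - ‖x i‖) ^ 2 := by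
      nlinarith [norm_nonneg (u k i), norm_nonneg (x i), norm_nonneg (x i + u k i),
        sq_nonneg (‖x i + u k i‖ - ‖x i‖ - 2 * ‖x i‖)]
    rcases min_choice (‖u k i‖ ^ 2) (8 * ‖x i‖ ^ 2) with h | h <;> rw [h]
    · nlinarith [sq_nonneg (‖x i + u k i‖ - ‖x i‖)]
    · linarith
  have hu2 : Tendsto (fun k => ‖u k‖ ^ 2) atTop (𝓝 0) :=
    squeeze_zero (fun k => sq_nonneg _) hbound (by simpa using hmin.add (htot.const_mul 2))
  simpa using hu2.sqrt

theorem HasStrongMidpoints.isMLUR {X : Type*} [NormedAddCommGroup X]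
    (h : HasStrongMidpoints X) : IsMLUR X := fun x hx u h1 h2 =>
  tendsto_zero_iff_norm_tendsto_zero.2 (h x u (by rwa [hx]) (by rwa [hx]))

/-! ### Multiplication operators -/

theorem dNorm_mul_le (D : NbhdBase) {φ : C(unitInterval, ℝ)} (x : C(unitInterval, ℝ)) {c : ℝ}
    (hφ : ∀ s, |φ s| ≤ c) : dNorm D (φ * x) ≤ c * dNorm D x := by
  have hc : 0 ≤ c := (abs_nonneg _).trans (hφ 0)
  have h := dNorm_mono_abs D (x := φ * x) (y := c • x) fun s => by
    simp only [ContinuousMap.mul_apply, ContinuousMap.smul_apply, smul_eq_mul, abs_mul,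
      abs_of_nonneg hc]
    exact mul_le_mul_of_nonneg_right (hφ s) (abs_nonneg _)
  rwa [dNorm_smul, abs_of_nonneg hc] at h

/-- The function underlying an element of `X_D`. -/
def XSpace.toFun {D : NbhdBase} (x : XSpace D) : C(unitInterval, ℝ) := x

/-- The product of an element of `X_D` with a continuous function. -/
noncomputable def XSpace.mul {D : NbhdBase} (φ : C(unitInterval, ℝ)) (x : XSpace D) : XSpace D :=
  (φ * x.toFun : C(unitInterval, ℝ))

theorem XSpace.norm_mul_le {D : NbhdBase} {φ : C(unitInterval, ℝ)} (x : XSpace D) {c : ℝ}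
    (hφ : ∀ s, |φ s| ≤ c) : ‖XSpace.mul φ x‖ ≤ c * ‖x‖ :=
  dNorm_mul_le D x hφ

variable {D : ℕ → NbhdBase}

/-- Coordinatewise multiplication by a continuous function on an `ℓ_2`-sum of spaces `X_D`, as a
linear function of the multiplier. -/
noncomputable def mulLp (x : lp (fun i => XSpace (D i)) 2) :
    C(unitInterval, ℝ) →ₗ[ℝ] lp (fun i => XSpace (D i)) 2 where
  toFun φ := ⟨fun i => XSpace.mul φ (x i), memℓp_two_of_summable_sq <|
    Summable.of_nonneg_of_le (fun i => sq_nonneg _)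
      (fun i => pow_le_pow_left₀ (norm_nonneg _)
        (XSpace.norm_mul_le (x i) fun s => φ.norm_coe_le_norm s) 2)
      (by simpa only [mul_pow] using (lp_two_hasSum_sq x).summable.mul_left (‖φ‖ ^ 2))⟩
  map_add' φ ψ := by
    refine lp.ext (funext fun i => ?_)
    exact add_mul φ ψ (x i).toFun
  map_smul' c φ := by
    refine lp.ext (funext fun i => ?_)
    exact smul_mul_assoc c φ (x i).toFun

theorem mulLp_one (x : lp (fun i => XSpace (D i)) 2) : mulLp x 1 = x :=
  lp.ext (funext fun i => one_mul (x i).toFun)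

theorem norm_mulLp_le (x : lp (fun i => XSpace (D i)) 2) {φ : C(unitInterval, ℝ)} {c : ℝ}
    (hφ : ∀ s, |φ s| ≤ c) : ‖mulLp x φ‖ ≤ c * ‖x‖ := by
  have hc : 0 ≤ c := (abs_nonneg _).trans (hφ 0)
  refine le_of_sq_le_sq ?_ (by positivity)
  have h := (lp_two_hasSum_sq x).mul_left (c ^ 2)
  rw [mul_pow]
  refine hasSum_le (fun i => ?_) (lp_two_hasSum_sq (mulLp x φ)) h
  rw [← mul_pow]
  exact pow_le_pow_left₀ (norm_nonneg _) (XSpace.norm_mul_le (x i) hφ) 2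

/-! ### Weakly null sequences -/

/-- Choosing `σ k` as the sign of `f (v k)` bounds the partial sums of `∑ |f (v k)|` by `‖f‖ * C`,
so the series converges. -/
theorem tendsto_zero_of_bounded_signed_sums {E : Type*} [NormedAddCommGroup E] [NormedSpace ℝ E]
    {v : ℕ → E} {C : ℝ}
    (hv : ∀ (F : Finset ℕ) (σ : ℕ → ℝ), (∀ k, |σ k| ≤ 1) → ‖∑ k ∈ F, σ k • v k‖ ≤ C)
    (f : StrongDual ℝ E) : Tendsto (fun k => f (v k)) atTop (𝓝 0) := by
  have hsum : Summable fun k => |f (v k)| := by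
    refine summable_of_sum_le (c := ‖f‖ * C) (fun k => abs_nonneg _) fun F => ?_
    have h1 : ∑ k ∈ F, |f (v k)| = f (∑ k ∈ F, (SignType.sign (f (v k)) : ℝ) • v k) := by
      simp [map_sum, sign_mul_self]
    rw [h1]
    refine (le_abs_self _).trans ((f.le_opNorm _).trans ?_)
    refine mul_le_mul_of_nonneg_left (hv F _ fun k => ?_) (norm_nonneg _)
    rcases SignType.trichotomy (SignType.sign (f (v k))) with h | h | h <;> simp [h]
  exact (tendsto_zero_iff_abs_tendsto_zero _).2 hsum.tendsto_atTop_zero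

theorem tendsto_toWeakSpace {E : Type*} [NormedAddCommGroup E] [NormedSpace ℝ E] {y : ℕ → E}
    {x : E} (h : ∀ f : StrongDual ℝ E, Tendsto (fun k => f (y k)) atTop (𝓝 (f x))) :
    Tendsto (fun k => toWeakSpace ℝ E (y k)) atTop (𝓝 (toWeakSpace ℝ E x)) := by
  have hind : IsInducing fun (z : WeakSpace ℝ E) (f : StrongDual ℝ E) =>
      (topDualPairing ℝ E).flip z f := ⟨rfl⟩
  exact hind.tendsto_nhds_iff.2 (tendsto_pi_nhds.2 h)

/-! ### Oscillating bumps -/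

/-- The bump `max(0, 1 - 2^{k+2} |v - 2^{-k}|)` at `v = sin (M s)`. -/
noncomputable def sinBump (M k : ℕ) : C(unitInterval, ℝ) where
  toFun s := max 0 (1 - 4 * 2 ^ k * |Real.sin (M * s) - (1 / 2) ^ k|)
  continuous_toFun := by fun_prop

theorem sinBump_nonneg (M k : ℕ) (s : unitInterval) : 0 ≤ sinBump M k s := le_max_left _ _

theorem sinBump_le_one (M k : ℕ) (s : unitInterval) : sinBump M k s ≤ 1 :=
  max_le zero_le_one (sub_le_self _ (by positivity))

theorem abs_sinBump_le_one (M k : ℕ) (s : unitInterval) : |sinBump M k s| ≤ 1 :=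
  (abs_of_nonneg (sinBump_nonneg M k s)).trans_le (sinBump_le_one M k s)

/-- The `k`-th bump lives where `sin (M s)` is within `2^{-k}/4` of `2^{-k}`, and `(5/4) 2^{-(j+1)}
< (3/4) 2^{-j}` keeps these ranges apart. -/
theorem sinBump_eq_zero_of_lt (M : ℕ) {j k : ℕ} (hjk : j < k) (s : unitInterval)
    (h : sinBump M j s ≠ 0) : sinBump M k s = 0 := by
  have key : ∀ k, sinBump M k s ≠ 0 → |Real.sin (M * s) - (1 / 2) ^ k| < (1 / 2) ^ k / 4 := by
    intro k hk
    by_contra hcon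
    refine hk (max_eq_left ?_)
    have e : (2 : ℝ) ^ k * (1 / 2) ^ k = 1 := by rw [← mul_pow]; norm_num
    have := mul_le_mul_of_nonneg_left (not_lt.1 hcon) (by positivity : (0 : ℝ) ≤ 4 * 2 ^ k)
    nlinarith
  by_contra hk
  have h1 := abs_lt.1 (key j h)
  have h2 := abs_lt.1 (key k hk)
  have h3 : (1 / 2 : ℝ) ^ k ≤ (1 / 2) ^ (j + 1) :=
    pow_le_pow_of_le_one (by norm_num) (by norm_num) hjk
  rw [pow_succ] at h3
  have h4 : (0 : ℝ) < (1 / 2) ^ j := by positivity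
  linarith [h1.1, h2.2]

theorem abs_sum_smul_sinBump_le (M : ℕ) (F : Finset ℕ) {σ : ℕ → ℝ} (hσ : ∀ k, |σ k| ≤ 1)
    (s : unitInterval) : |(∑ k ∈ F, σ k • sinBump M k) s| ≤ 1 := by
  have e : (∑ k ∈ F, σ k • sinBump M k) s = ∑ k ∈ F, σ k * sinBump M k s := by
    simp [ContinuousMap.sum_apply]
  rw [e]
  by_cases h : ∃ j ∈ F, sinBump M j s ≠ 0
  · obtain ⟨j, hj, hne⟩ := h
    rw [Finset.sum_eq_single_of_mem j hj]
    · rw [abs_mul]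
      exact mul_le_one₀ (hσ j) (abs_nonneg _) (abs_sinBump_le_one M j s)
    · intro k _ hkj
      rcases lt_or_gt_of_ne hkj with hlt | hlt
      · by_cases hk : sinBump M k s = 0
        · rw [hk, mul_zero]
        · exact absurd (sinBump_eq_zero_of_lt M hlt s hk) hne
      · rw [sinBump_eq_zero_of_lt M hlt s hne, mul_zero]
  · push Not at h
    rw [Finset.sum_eq_zero fun k hk => by rw [h k hk, mul_zero]]
    simp

theorem tendsto_apply_mulLp_sinBump (x : lp (fun i => XSpace (D i)) 2) (M : ℕ)
    (f : StrongDual ℝ (lp (fun i => XSpace (D i)) 2)) :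
    Tendsto (fun k => f (mulLp x (sinBump M k))) atTop (𝓝 0) := by
  refine tendsto_zero_of_bounded_signed_sums (C := 1 * ‖x‖) (fun F σ hσ => ?_) f
  simp_rw [← map_smul, ← map_sum]
  exact norm_mulLp_le x (abs_sum_smul_sinBump_le M F hσ)

/-- The filter `comap Prod.fst atTop` expresses uniformity in `k`: once `V` contains a full period
of `sin (M s)`, all values `2^{-k}` are attained in it. -/
theorem eventually_exists_sinBump_eq_one {V : Set unitInterval} (hV : IsOpen V)
    (hne : V.Nonempty) :
    ∀ᶠ p : ℕ × ℕ in comap Prod.fst atTop, ∃ s ∈ V, sinBump p.1 p.2 s = 1 := by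
  obtain ⟨W, hW, rfl⟩ := isOpen_induced_iff.1 hV
  obtain ⟨t, ht⟩ := hne
  -- Moving to an interior point `c` allows a two-sided real neighbourhood inside `[0,1]`.
  have hcl : (t : ℝ) ∈ closure (Ioo (0 : ℝ) 1) := by
    rw [closure_Ioo zero_ne_one]; exact t.2
  obtain ⟨c, hcW, hc01⟩ := mem_closure_iff.1 hcl W hW ht
  obtain ⟨r, hr, hball⟩ := Metric.isOpen_iff.1 (hW.inter isOpen_Ioo) c ⟨hcW, hc01⟩
  have hlarge : ∀ᶠ M : ℕ in atTop, 2 * Real.pi / r < M :=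
    tendsto_natCast_atTop_atTop.eventually_gt_atTop _
  filter_upwards [tendsto_comap.eventually hlarge] with p hp
  have hM : (0 : ℝ) < p.1 := lt_trans (by positivity) hp
  -- The solution of `sin y = 2^{-k}` in `[M c, M c + 2π)`; then `y / M` is within `2π / M < r` of
  -- `c`.
  obtain ⟨m, hm, -⟩ := existsUnique_add_zsmul_mem_Ico Real.two_pi_pos
    (Real.arcsin ((1 / 2) ^ p.2)) (p.1 * c)
  set y := Real.arcsin ((1 / 2) ^ p.2) + m • (2 * Real.pi) with hy
  have hsin : Real.sin y = (1 / 2) ^ p.2 := by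
    rw [hy, zsmul_eq_mul, Real.sin_add_int_mul_two_pi, Real.sin_arcsin]
    · exact le_trans (by norm_num) (by positivity : (0 : ℝ) ≤ (1 / 2) ^ p.2)
    · exact pow_le_one₀ (by norm_num) (by norm_num)
  have hmem : y / p.1 ∈ W ∩ Ioo 0 1 := by
    apply hball
    rw [Metric.mem_ball, Real.dist_eq, abs_of_nonneg]
    · rw [sub_lt_iff_lt_add, div_lt_iff₀ hM]
      rw [div_lt_iff₀ hr] at hp
      nlinarith [hm.2]
    · rw [sub_nonneg, le_div_iff₀ hM]
      linarith [hm.1]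
  refine ⟨⟨y / p.1, hmem.2.1.le, hmem.2.2.le⟩, hmem.1, ?_⟩
  change max 0 (1 - 4 * 2 ^ p.2 * |Real.sin (p.1 * (y / p.1)) - (1 / 2) ^ p.2|) = 1
  rw [mul_div_cancel₀ _ hM.ne', hsin]
  simp

theorem tendsto_supOn_sinBump_mul {A : Set unitInterval} (hA : IsOpen A) (hne : A.Nonempty)
    (x : C(unitInterval, ℝ)) :
    Tendsto (fun p : ℕ × ℕ => supOn A (sinBump p.1 p.2 * x)) (comap Prod.fst atTop)
      (𝓝 (supOn A x)) := by
  have hle : ∀ p : ℕ × ℕ, supOn A (sinBump p.1 p.2 * x) ≤ supOn A x := fun p =>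
    supOn_mono_abs A fun s _ => by
      rw [ContinuousMap.mul_apply, abs_mul]
      exact mul_le_of_le_one_left (abs_nonneg _) (abs_sinBump_le_one _ _ s)
  refine tendsto_order.2 ⟨fun a ha => ?_, fun a ha => Eventually.of_forall fun p =>
    (hle p).trans_lt ha⟩
  have : Nonempty A := hne.to_subtype
  obtain ⟨t, ht⟩ := exists_lt_of_lt_ciSup ha
  have hV : IsOpen (A ∩ {s | a < |x s|}) :=
    hA.inter (isOpen_lt continuous_const (by fun_prop))
  filter_upwards [eventually_exists_sinBump_eq_one hV ⟨t, t.2, ht⟩] with p ⟨s, hs, hs1⟩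
  refine lt_of_lt_of_le hs.2 ?_
  have := le_supOn (sinBump p.1 p.2 * x) hs.1
  rwa [ContinuousMap.mul_apply, hs1, one_mul] at this

theorem tendsto_dNorm_sinBump_mul (D : NbhdBase) (x : C(unitInterval, ℝ)) :
    Tendsto (fun p : ℕ × ℕ => dNorm D (sinBump p.1 p.2 * x)) (comap Prod.fst atTop)
      (𝓝 (dNorm D x)) := by
  refine (Real.continuous_sqrt.tendsto _).comp ?_
  refine tendsto_tsum_of_dominated_convergence (dNorm_summable D x)
    (fun n => ((tendsto_supOn_sinBump_mul (D.isOpen_sets n) (D.nonempty n) x).pow 2).const_mul _)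
    (Eventually.of_forall fun p n => ?_)
  rw [Real.norm_of_nonneg (by positivity)]
  have h : supOn (D.sets n) (sinBump p.1 p.2 * x) ≤ supOn (D.sets n) x :=
    supOn_mono_abs _ fun s _ => by
      rw [ContinuousMap.mul_apply, abs_mul]
      exact mul_le_of_le_one_left (abs_nonneg _) (abs_sinBump_le_one _ _ s)
  have h0 := supOn_nonneg (D.sets n) (sinBump p.1 p.2 * x)
  gcongr

theorem tendsto_norm_mulLp_sinBump (x : lp (fun i => XSpace (D i)) 2) :
    Tendsto (fun p : ℕ × ℕ => ‖mulLp x (sinBump p.1 p.2)‖) (comap Prod.fst atTop) (𝓝 ‖x‖) := by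
  have h : Tendsto (fun p : ℕ × ℕ => ‖mulLp x (sinBump p.1 p.2)‖ ^ 2) (comap Prod.fst atTop)
      (𝓝 (‖x‖ ^ 2)) := by
    simp_rw [← (lp_two_hasSum_sq _).tsum_eq]
    refine tendsto_tsum_of_dominated_convergence (lp_two_hasSum_sq x).summable
      (fun i => (tendsto_dNorm_sinBump_mul (D i) (x i)).pow 2)
      (Eventually.of_forall fun p i => ?_)
    rw [Real.norm_of_nonneg (sq_nonneg _)]
    refine pow_le_pow_left₀ (norm_nonneg _) ?_ 2
    exact (XSpace.norm_mul_le (x i) (abs_sinBump_le_one p.1 p.2)).trans_eq (one_mul _)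
  simpa using h.sqrt

/-! ### Diameter two properties -/

/-- Every point `x` of the unit sphere is the weak limit of a sequence in the unit ball whose
members have distance almost `2` to `x`. -/
def HasFarWeakApprox (X : Type*) [NormedAddCommGroup X] [NormedSpace ℝ X] : Prop :=
  ∀ x : X, ‖x‖ = 1 → ∀ δ : ℝ, 0 < δ → ∃ y : ℕ → X, (∀ k, ‖y k‖ ≤ 1) ∧
    (∀ f : StrongDual ℝ X, Tendsto (fun k => f (y k)) atTop (𝓝 (f x))) ∧ ∀ k, 2 - δ < ‖x - y k‖

theorem hasFarWeakApprox_lp (D : ℕ → NbhdBase) :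
    HasFarWeakApprox (lp (fun i => XSpace (D i)) 2) := by
  intro x hx δ hδ
  have h := (tendsto_norm_mulLp_sinBump x).eventually_const_lt
    (show 1 - δ / 2 < ‖x‖ by rw [hx]; linarith)
  -- One frequency serves all `k`, so `k` remains free for the weak limit.
  obtain ⟨M, hM⟩ := (eventually_comap.1 h).exists
  refine ⟨fun k => x - (2 : ℝ) • mulLp x (sinBump M k), fun k => ?_, fun f => ?_, fun k => ?_⟩
  · have e : x - (2 : ℝ) • mulLp x (sinBump M k) = mulLp x (1 - (2 : ℝ) • sinBump M k) := by
      rw [map_sub, map_smul, mulLp_one]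
    have := norm_mulLp_le x (φ := 1 - (2 : ℝ) • sinBump M k) (c := 1) fun s => by
      have h0 := sinBump_nonneg M k s
      have h1 := sinBump_le_one M k s
      simp only [ContinuousMap.sub_apply, ContinuousMap.one_apply, ContinuousMap.smul_apply,
        smul_eq_mul]
      rw [abs_le]; constructor <;> linarith
    rw [hx, one_mul] at this
    exact (congrArg norm e).trans_le this
  · have := ((tendsto_apply_mulLp_sinBump x M f).const_mul 2).const_sub (f x)
    simpa using this
  · have := hM (M, k) rfl
    simp only [sub_sub_cancel, norm_smul, Real.norm_of_nonneg two_pos.le]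
    linarith

theorem HasFarWeakApprox.hasLD2PPlus {X : Type*} [NormedAddCommGroup X] [NormedSpace ℝ X]
    (h : HasFarWeakApprox X) : HasLD2PPlus X := by
  intro f _ ε _ δ hδ x hx hx1
  obtain ⟨y, hy1, hyf, hyx⟩ := h x hx1 δ hδ
  obtain ⟨k, hk⟩ := ((hyf f).eventually_const_lt hx.2).exists
  exact ⟨y k, ⟨mem_closedBall_zero_iff.2 (hy1 k), hk⟩, hyx k⟩

/-- A weakly open set which meets the unit ball meets the unit sphere. -/
theorem HasFarWeakApprox.exists_norm_eq_one {X : Type*} [NormedAddCommGroup X] [NormedSpace ℝ X]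
    [Nontrivial X] (h : HasFarWeakApprox X) {U : Set (WeakSpace ℝ X)} (hU : IsOpen U) {x : X}
    (hx : ‖x‖ ≤ 1) (hxU : toWeakSpace ℝ X x ∈ U) : ∃ z : X, ‖z‖ = 1 ∧ toWeakSpace ℝ X z ∈ U := by
  obtain ⟨e, he⟩ := exists_norm_eq X zero_le_one
  -- The sequence `y k - e` is weakly null with norms above 1, so adding `2 • (y k - e)` to `x`
  -- leaves the open ball, and some multiple in between hits the sphere.
  obtain ⟨y, -, hyf, hye⟩ := h e he 1 one_pos
  have ht : ∀ k, ∃ t ∈ Icc (0 : ℝ) 2, ‖x + t • (y k - e)‖ = 1 := by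
    intro k
    have hcont : ContinuousOn (fun t : ℝ => ‖x + t • (y k - e)‖) (Icc 0 2) := by fun_prop
    have h2 : 1 ≤ ‖x + (2 : ℝ) • (y k - e)‖ := by
      have h3 := hye k
      rw [norm_sub_rev] at h3
      have h4 := norm_sub_le_norm_add ((2 : ℝ) • (y k - e)) x
      rw [norm_smul, Real.norm_of_nonneg two_pos.le, add_comm] at h4
      linarith
    obtain ⟨t, ht, hval⟩ := intermediate_value_Icc two_pos.le hcont
      ⟨by simpa using hx, h2⟩
    exact ⟨t, ht, hval⟩
  choose t ht ht1 using ht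
  have hlim : Tendsto (fun k => toWeakSpace ℝ X (x + t k • (y k - e))) atTop
      (𝓝 (toWeakSpace ℝ X x)) := by
    refine tendsto_toWeakSpace fun f => ?_
    have h0 : Tendsto (fun k => f (y k) - f e) atTop (𝓝 0) := by
      simpa using (hyf f).sub_const (f e)
    have h1 : Tendsto (fun k => t k * (f (y k) - f e)) atTop (𝓝 0) := by
      refine bdd_le_mul_tendsto_zero (b := 0) (B := 2) ?_ ?_ h0
      · exact Eventually.of_forall fun k => (ht k).1
      · exact Eventually.of_forall fun k => (ht k).2
    simpa using h1.const_add (f x)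
  obtain ⟨k, hk⟩ := (hlim.eventually (hU.mem_nhds hxU)).exists
  exact ⟨_, ht1 k, hk⟩

theorem HasFarWeakApprox.hasD2P {X : Type*} [NormedAddCommGroup X] [NormedSpace ℝ X]
    [Nontrivial X] (h : HasFarWeakApprox X) : HasD2P X := by
  rintro U hU ⟨x₀, hx₀, hx₀U⟩
  obtain ⟨x, hx, hxU⟩ := h.exists_norm_eq_one hU (mem_closedBall_zero_iff.1 hx₀) hx₀U
  refine le_antisymm ?_ (le_of_forall_sub_le fun δ hδ => ?_)
  · have := Metric.diam_closedBall (x := (0 : X)) zero_le_one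
    rw [mul_one] at this
    exact (Metric.diam_mono inter_subset_left Metric.isBounded_closedBall).trans this
  · obtain ⟨y, hy1, hyf, hyx⟩ := h x hx δ hδ
    obtain ⟨k, hk⟩ := ((tendsto_toWeakSpace hyf).eventually (hU.mem_nhds hxU)).exists
    refine (hyx k).le.trans ?_
    rw [← dist_eq_norm]
    exact Metric.dist_le_diam_of_mem
      (Metric.isBounded_closedBall.subset inter_subset_left)
      ⟨mem_closedBall_zero_iff.2 hx.le, hxU⟩ ⟨mem_closedBall_zero_iff.2 (hy1 k), hk⟩

/-! ### Slices given by point evaluations -/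

theorem pow_mul_supOn_sq_le (D : NbhdBase) (x : C(unitInterval, ℝ)) (n : ℕ) :
    (1 / 2 : ℝ) ^ (n + 1) * supOn (D.sets n) x ^ 2 ≤ dNorm D x ^ 2 :=
  le_hasSum (dNorm_hasSum_sq D x) n fun _ _ => by positivity

theorem exists_abs_apply_le_dNorm (D : NbhdBase) (t : unitInterval) :
    ∃ C : ℝ, ∀ x : C(unitInterval, ℝ), |x t| ≤ C * dNorm D x := by
  obtain ⟨n, ht, -⟩ := D.exists_mem_subset (t := t) univ_mem
  refine ⟨2 ^ (n + 1), fun x => le_of_sq_le_sq ?_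
    (mul_nonneg (by positivity) (dNorm_nonneg D x))⟩
  have h1 := pow_mul_supOn_sq_le D x n
  have h2 : |x t| ^ 2 ≤ supOn (D.sets n) x ^ 2 :=
    pow_le_pow_left₀ (abs_nonneg _) (le_supOn x ht) 2
  have h3 : (1 : ℝ) ≤ 2 ^ (n + 1) := one_le_pow₀ (by norm_num)
  rw [one_div_pow, one_div, inv_mul_le_iff₀ (by positivity)] at h1
  calc |x t| ^ 2 ≤ 2 ^ (n + 1) * dNorm D x ^ 2 := h2.trans h1
    _ ≤ (2 ^ (n + 1)) ^ 2 * dNorm D x ^ 2 := by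
        refine mul_le_mul_of_nonneg_right ?_ (sq_nonneg _)
        nlinarith
    _ = _ := by ring

/-- Evaluation of the first coordinate at the point `t`. -/
noncomputable def evalFirst (D : ℕ → NbhdBase) (t : unitInterval) :
    StrongDual ℝ (lp (fun i => XSpace (D i)) 2) :=
  LinearMap.mkContinuousOfExistsBound
    { toFun := fun x => (x 0).toFun t
      map_add' := fun _ _ => rfl
      map_smul' := fun _ _ => rfl } <| by
    obtain ⟨C, hC⟩ := exists_abs_apply_le_dNorm (D 0) t
    refine ⟨max C 0, fun x => (hC (x 0)).trans ?_⟩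
    exact mul_le_mul (le_max_left _ _) (lp.norm_apply_le_norm two_ne_zero x 0)
      (dNorm_nonneg _ _) (le_max_right _ _)

theorem evalFirst_apply (t : unitInterval) (x : lp (fun i => XSpace (D i)) 2) :
    evalFirst D t x = (x 0).toFun t := rfl

theorem evalFirst_single (t : unitInterval) (x : XSpace (D 0)) :
    evalFirst D t (lp.single 2 0 x) = x.toFun t := by
  rw [evalFirst_apply, lp.single_apply_self]

theorem evalFirst_ne_zero (t : unitInterval) : evalFirst D t ≠ 0 := by
  intro h
  have h1 := evalFirst_single (D := D) t (1 : C(unitInterval, ℝ))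
  rw [h] at h1
  exact zero_ne_one h1

theorem nontrivial_lp (D : ℕ → NbhdBase) : Nontrivial (lp (fun i => XSpace (D i)) 2) := by
  by_contra h
  rw [not_nontrivial_iff_subsingleton] at h
  exact evalFirst_ne_zero (D := D) 0 (Subsingleton.elim _ _)

/-- The normalized evaluation of the first coordinate at `t`. -/
noncomputable def unitEvalFirst (D : ℕ → NbhdBase) (t : unitInterval) :
    StrongDual ℝ (lp (fun i => XSpace (D i)) 2) :=
  ‖evalFirst D t‖⁻¹ • evalFirst D t

theorem norm_unitEvalFirst (t : unitInterval) : ‖unitEvalFirst D t‖ = 1 :=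
  norm_smul_inv_norm (𝕜 := ℝ) (evalFirst_ne_zero t)

/-- On a slice of `unitEvalFirst D t`, multiplying the first coordinate by `φ` with `φ t = 1`
does not decrease the norm much. -/
theorem lt_norm_mul_of_mem_ballSlice {t : unitInterval} {η : ℝ}
    {x : lp (fun i => XSpace (D i)) 2} (hx : x ∈ ballSlice (unitEvalFirst D t) η)
    {φ : C(unitInterval, ℝ)} (hφ : φ t = 1) : 1 - η < ‖XSpace.mul φ (x 0)‖ := by
  have h1 : unitEvalFirst D t (lp.single 2 0 (XSpace.mul φ (x 0))) = unitEvalFirst D t x := by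
    change ‖evalFirst D t‖⁻¹ • evalFirst D t (lp.single 2 0 (XSpace.mul φ (x 0))) =
      ‖evalFirst D t‖⁻¹ • evalFirst D t x
    rw [evalFirst_single, evalFirst_apply]
    congr 1
    change φ t * (x 0).toFun t = (x 0).toFun t
    rw [hφ, one_mul]
  have h2 := (unitEvalFirst D t).le_opNorm (lp.single 2 0 (XSpace.mul φ (x 0)))
  rw [norm_unitEvalFirst, one_mul, lp.norm_single (by norm_num), h1] at h2
  exact hx.2.trans_le ((le_abs_self _).trans h2)

/-- Multiplication by `φ` increases no term of the square sum and deletes the `n`-th one. -/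
theorem dNorm_sq_add_le (D : NbhdBase) {x φ : C(unitInterval, ℝ)} (hφ : ∀ s, |φ s| ≤ 1) {n : ℕ}
    (hn : ∀ s ∈ D.sets n, φ s = 0) :
    dNorm D (φ * x) ^ 2 + (1 / 2 : ℝ) ^ (n + 1) * supOn (D.sets n) x ^ 2 ≤ dNorm D x ^ 2 := by
  refine hasSum_le (fun k => ?_) ((dNorm_hasSum_sq D (φ * x)).add
    (hasSum_ite_eq n ((1 / 2 : ℝ) ^ (n + 1) * supOn (D.sets n) x ^ 2))) (dNorm_hasSum_sq D x)
  by_cases hk : k = n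
  · subst hk
    have h0 : supOn (D.sets k) (φ * x) = 0 := by
      refine le_antisymm (Real.iSup_le (fun d => ?_) le_rfl) (supOn_nonneg _ _)
      rw [ContinuousMap.mul_apply, hn d d.2, zero_mul, abs_zero]
    simp [h0]
  · have h : supOn (D.sets k) (φ * x) ≤ supOn (D.sets k) x :=
      supOn_mono_abs _ fun s _ => by
        rw [ContinuousMap.mul_apply, abs_mul]
        exact mul_le_of_le_one_left (abs_nonneg _) (hφ s)
    have h0 := supOn_nonneg (D.sets k) (φ * x)
    rw [if_neg hk, add_zero]
    gcongr

theorem lp_two_norm_sub_single_sq {E : ℕ → Type*} [∀ i, NormedAddCommGroup (E i)]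
    (x : lp E 2) (i : ℕ) : ‖x - lp.single 2 i (x i)‖ ^ 2 = ‖x‖ ^ 2 - ‖x i‖ ^ 2 := by
  have h := lp.norm_compl_sum_single (p := 2) (by norm_num) x {i}
  simpa [ENNReal.toReal_ofNat, Real.rpow_two] using h

theorem sq_le_two_mul_of_mem_ballSlice {t : unitInterval} {η : ℝ} (hη1 : η ≤ 1)
    {x : lp (fun i => XSpace (D i)) 2} (hx : x ∈ ballSlice (unitEvalFirst D t) η) :
    ‖x - lp.single 2 0 (x 0)‖ ^ 2 ≤ 2 * η := by
  have h1 := lt_norm_mul_of_mem_ballSlice hx (φ := 1) rfl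
  have h2 : XSpace.mul 1 (x 0) = x 0 := one_mul (x 0).toFun
  have h3 : ‖x‖ ≤ 1 := mem_closedBall_zero_iff.1 hx.1
  rw [h2] at h1
  rw [lp_two_norm_sub_single_sq]
  nlinarith [norm_nonneg x, sq_nonneg η]

/-- The cut-off function still has norm above `1 - η`, so the deleted term is at most `1 - (1 - η)²
≤ 2η`. -/
theorem pow_mul_supOn_sq_le_of_mem_ballSlice {t : unitInterval} {η : ℝ} (hη1 : η ≤ 1)
    {x : lp (fun i => XSpace (D i)) 2} (hx : x ∈ ballSlice (unitEvalFirst D t) η)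
    {φ : C(unitInterval, ℝ)} (hφ : φ t = 1) (hφ1 : ∀ s, |φ s| ≤ 1) {n : ℕ}
    (hn : ∀ s ∈ (D 0).sets n, φ s = 0) :
    (1 / 2 : ℝ) ^ (n + 1) * supOn ((D 0).sets n) (x 0).toFun ^ 2 ≤ 2 * η := by
  have h1 : 1 - η < dNorm (D 0) (φ * (x 0).toFun) := lt_norm_mul_of_mem_ballSlice hx hφ
  have h2 := dNorm_sq_add_le (D 0) (x := (x 0).toFun) hφ1 hn
  have h3 : dNorm (D 0) (x 0).toFun ≤ 1 :=
    (lp.norm_apply_le_norm two_ne_zero x 0).trans (mem_closedBall_zero_iff.1 hx.1)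
  nlinarith [dNorm_nonneg (D 0) (x 0).toFun, sq_nonneg η]

/-- Thin slices at the evaluation of the first coordinate at `t` consist of elements which are
small except in the first coordinate and near `t`. -/
theorem exists_ballSlice_small (D : ℕ → NbhdBase) (t : unitInterval) {r ρ : ℝ} (hr : 0 < r)
    (hρ : 0 < ρ) : ∃ η : ℝ, 0 < η ∧ ∀ x ∈ ballSlice (unitEvalFirst D t) η,
      (∀ s : unitInterval, r ≤ |(s : ℝ) - t| → |(x 0).toFun s| ≤ ρ) ∧
        ‖x - lp.single 2 0 (x 0)‖ ≤ ρ := by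
  -- The tent has radius `r / 2`, not `r`, so that it vanishes on a neighbourhood of the compact set
  -- `r ≤ |s - t|`, which finitely many basic sets then cover.
  let φ : C(unitInterval, ℝ) := ⟨fun s => max 0 (1 - 2 / r * |(s : ℝ) - t|), by fun_prop⟩
  have hφt : φ t = 1 := by simp [φ]
  have hφ1 : ∀ s, |φ s| ≤ 1 := fun s => by
    rw [abs_of_nonneg (le_max_left _ _)]
    exact max_le zero_le_one (sub_le_self _ (by positivity))
  have hφ0 : ∀ s : unitInterval, r / 2 < |(s : ℝ) - t| → φ s = 0 := fun s hs => by
    refine max_eq_left ?_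
    rw [sub_nonpos, div_mul_eq_mul_div, le_div_iff₀ hr]
    linarith
  have hK : IsCompact {s : unitInterval | r ≤ |(s : ℝ) - t|} :=
    (isClosed_le continuous_const (by fun_prop)).isCompact
  obtain ⟨F, hF⟩ := hK.elim_finite_subcover
    (fun n : {n // ∀ s ∈ (D 0).sets n, φ s = 0} => (D 0).sets n)
    (fun n => (D 0).isOpen_sets n) (fun s hs => by
      have hV : {s : unitInterval | r / 2 < |(s : ℝ) - t|} ∈ 𝓝 s := by
        refine (isOpen_lt continuous_const (by fun_prop)).mem_nhds ?_
        have hs' : r ≤ |(s : ℝ) - t| := hs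
        change r / 2 < |(s : ℝ) - t|
        linarith
      obtain ⟨n, hsn, hn⟩ := (D 0).exists_mem_subset hV
      exact mem_iUnion.2 ⟨⟨n, fun s' hs' => hφ0 s' (hn hs')⟩, hsn⟩)
  set N := F.sup Subtype.val
  -- A lower bound for the weights of the finitely many covering sets; it dictates how thin the
  -- slice must be.
  set w : ℝ := (1 / 2) ^ (N + 1) with hw
  have hw0 : 0 < w := by positivity
  have hw1 : w ≤ 1 := pow_le_one₀ (by norm_num) (by norm_num)
  refine ⟨min 1 (ρ ^ 2 * w / 2), by positivity, fun x hx => ?_⟩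
  have hη : 2 * min 1 (ρ ^ 2 * w / 2) ≤ ρ ^ 2 * w := by
    linarith [min_le_right 1 (ρ ^ 2 * w / 2)]
  refine ⟨fun s hs => ?_, ?_⟩
  · obtain ⟨n, hnF, hsn⟩ := mem_iUnion₂.1 (hF hs)
    have h1 := pow_mul_supOn_sq_le_of_mem_ballSlice (min_le_left _ _) hx hφt hφ1 n.2
    have hnN : (n : ℕ) ≤ N := Finset.le_sup (f := Subtype.val) hnF
    have h2 : w ≤ (1 / 2 : ℝ) ^ ((n : ℕ) + 1) :=
      pow_le_pow_of_le_one (by norm_num) (by norm_num) (by omega)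
    have h3 : supOn ((D 0).sets n) (x 0).toFun ≤ ρ := by
      refine le_of_sq_le_sq ?_ hρ.le
      refine le_of_mul_le_mul_left ?_ hw0
      calc w * supOn ((D 0).sets n) (x 0).toFun ^ 2
          ≤ (1 / 2 : ℝ) ^ ((n : ℕ) + 1) * supOn ((D 0).sets n) (x 0).toFun ^ 2 :=
            mul_le_mul_of_nonneg_right h2 (sq_nonneg _)
        _ ≤ ρ ^ 2 * w := h1.trans hη
        _ = w * ρ ^ 2 := mul_comm _ _
    exact (le_supOn _ hsn).trans h3
  · refine le_of_sq_le_sq ?_ hρ.le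
    refine (sq_le_two_mul_of_mem_ballSlice (min_le_left _ _) hx).trans (hη.trans ?_)
    exact mul_le_of_le_one_right (sq_nonneg _) hw1

/-! ### Sums of almost disjointly supported functions -/

/-- At most one `a j` exceeds `ρ` in modulus; split it off and use `(a + R)² ≤ 2a² + 2R²` with `|R|
≤ mρ`. The bounds `b j` will be the suprema over a basic set, where different points may have
different large summands. -/
theorem abs_sum_sq_le {m : ℕ} {a b : Fin m → ℝ} {ρ : ℝ} (hρ : 0 ≤ ρ) (hab : ∀ j, |a j| ≤ b j)
    (h : ∀ j k, j ≠ k → |a j| ≤ ρ ∨ |a k| ≤ ρ) :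
    (∑ j, a j) ^ 2 ≤ 2 * ∑ j, b j ^ 2 + 2 * (m * ρ) ^ 2 := by
  have hrest : ∀ F : Finset (Fin m), (∀ k ∈ F, |a k| ≤ ρ) → |∑ k ∈ F, a k| ≤ m * ρ := by
    intro F hF
    calc |∑ k ∈ F, a k| ≤ ∑ k ∈ F, |a k| := Finset.abs_sum_le_sum_abs _ _
      _ ≤ F.card • ρ := Finset.sum_le_card_nsmul _ _ _ hF
      _ ≤ m * ρ := by
        rw [nsmul_eq_mul]
        refine mul_le_mul_of_nonneg_right ?_ hρ
        exact_mod_cast (Finset.card_le_univ F).trans_eq (Fintype.card_fin m)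
  by_cases hj : ∃ j, ρ < |a j|
  · obtain ⟨j, hj⟩ := hj
    have h1 := hrest (Finset.univ.erase j) fun k hk =>
      (h j k (Finset.ne_of_mem_erase hk).symm).resolve_left (not_le.2 hj)
    have h2 : b j ^ 2 ≤ ∑ j, b j ^ 2 :=
      Finset.single_le_sum (f := fun j => b j ^ 2) (fun k _ => sq_nonneg _) (Finset.mem_univ j)
    have h3 : a j ^ 2 ≤ b j ^ 2 := sq_le_sq' (abs_le.1 (hab j)).1 (abs_le.1 (hab j)).2
    have h4 := sq_le_sq' (abs_le.1 h1).1 (abs_le.1 h1).2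
    rw [← Finset.add_sum_erase _ _ (Finset.mem_univ j)]
    nlinarith [sq_nonneg (a j - ∑ k ∈ Finset.univ.erase j, a k)]
  · push Not at hj
    have h1 := hrest Finset.univ fun k _ => hj k
    have h4 := sq_le_sq' (abs_le.1 h1).1 (abs_le.1 h1).2
    have h5 : 0 ≤ ∑ j, b j ^ 2 := Finset.sum_nonneg fun _ _ => sq_nonneg _
    nlinarith

theorem dNorm_sum_sq_le (D : NbhdBase) {m : ℕ} {x : Fin m → C(unitInterval, ℝ)} {ρ : ℝ}
    (hρ : 0 ≤ ρ) (hx : ∀ j, dNorm D (x j) ≤ 1)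
    (h : ∀ j k, j ≠ k → ∀ s, |x j s| ≤ ρ ∨ |x k s| ≤ ρ) :
    dNorm D (∑ j, x j) ^ 2 ≤ 2 * m + 2 * (m * ρ) ^ 2 := by
  have hsup : ∀ A : Set unitInterval,
      supOn A (∑ j, x j) ^ 2 ≤ 2 * ∑ j, supOn A (x j) ^ 2 + 2 * (m * ρ) ^ 2 := by
    intro A
    have h0 : 0 ≤ 2 * ∑ j, supOn A (x j) ^ 2 + 2 * (m * ρ) ^ 2 := by positivity
    refine (pow_le_pow_left₀ (supOn_nonneg _ _) (Real.iSup_le (fun d => Real.abs_le_sqrt ?_)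
      (Real.sqrt_nonneg _)) 2).trans_eq (Real.sq_sqrt h0)
    rw [ContinuousMap.sum_apply]
    exact abs_sum_sq_le hρ (fun j => le_supOn (x j) d.2) fun j k hjk => h j k hjk d
  have h1 : HasSum (fun n => (1 / 2 : ℝ) ^ (n + 1) *
      (2 * ∑ j, supOn (D.sets n) (x j) ^ 2 + 2 * (m * ρ) ^ 2))
      (2 * ∑ j, dNorm D (x j) ^ 2 + 2 * (m * ρ) ^ 2) := by
    have h2 := ((hasSum_sum fun j (_ : j ∈ Finset.univ) => dNorm_hasSum_sq D (x j)).mul_left 2).add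
      (hasSum_half_pow_succ.mul_right (2 * (m * ρ) ^ 2))
    rw [one_mul] at h2
    have e : ∀ n, (1 / 2 : ℝ) ^ (n + 1) *
        (2 * ∑ j, supOn (D.sets n) (x j) ^ 2 + 2 * (m * ρ) ^ 2) =
        2 * ∑ j, (1 / 2 : ℝ) ^ (n + 1) * supOn (D.sets n) (x j) ^ 2 +
          (1 / 2 : ℝ) ^ (n + 1) * (2 * (m * ρ) ^ 2) := fun n => by
      rw [← Finset.mul_sum]; ring
    simp_rw [e]
    exact h2
  have h2 := hasSum_le (fun n => mul_le_mul_of_nonneg_left (hsup (D.sets n)) (by positivity))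
    (dNorm_hasSum_sq D (∑ j, x j)) h1
  have h3 : ∑ j, dNorm D (x j) ^ 2 ≤ m := by
    calc ∑ j, dNorm D (x j) ^ 2 ≤ ∑ _j : Fin m, (1 : ℝ) :=
          Finset.sum_le_sum fun j _ => pow_le_one₀ (dNorm_nonneg D _) (hx j)
      _ = m := by simp
  linarith

/-! ### Small convex combinations of slices -/

theorem exists_convexCombOfSlices_norm_le (D : ℕ → NbhdBase) {m : ℕ} (hm : 0 < m) :
    ∃ C : Set (lp (fun i => XSpace (D i)) 2), IsConvexCombOfSlices C ∧
      ∀ z ∈ C, ‖z‖ ≤ 3 / Real.sqrt m := by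
  have hm0 : (0 : ℝ) < m := by exact_mod_cast hm
  have hm1 : (1 : ℝ) ≤ m := by exact_mod_cast hm
  let t : Fin m → unitInterval := fun j => ⟨(j : ℝ) / m, by positivity, by
    rw [div_le_one hm0]; exact_mod_cast j.2.le⟩
  have ht : ∀ j k, j ≠ k → 1 / (m : ℝ) ≤ |(t j : ℝ) - t k| := by
    intro j k hjk
    change 1 / (m : ℝ) ≤ |(j : ℝ) / m - (k : ℝ) / m|
    rw [← sub_div, abs_div, abs_of_pos hm0]
    refine div_le_div_of_nonneg_right ?_ hm0.le
    have : ((j : ℕ) : ℤ) - (k : ℕ) ≠ 0 := by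
      rw [sub_ne_zero]; exact_mod_cast fun h => hjk (Fin.ext h)
    exact_mod_cast Int.one_le_abs this
  -- The points are `1/m`-separated, so with radius `1/(2m)` no `s` is near two of them. The error
  -- `1/m` makes the total error of `m` summands at most 1.
  choose η hη hslice using fun j => exists_ballSlice_small D (t j)
    (show 0 < 1 / (2 * (m : ℝ)) by positivity) (show 0 < 1 / (m : ℝ) by positivity)
  refine ⟨_, ⟨m, fun _ => 1 / m, fun j => unitEvalFirst D (t j), η, fun _ => by positivity, ?_,
    fun j => norm_unitEvalFirst _, hη, rfl⟩, ?_⟩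
  · simp [hm0.ne']
  rintro z ⟨x, hx, rfl⟩
  have hsmall : ∀ j k, j ≠ k → ∀ s, |(x j 0).toFun s| ≤ 1 / m ∨ |(x k 0).toFun s| ≤ 1 / m := by
    intro j k hjk s
    by_cases hs : 1 / (2 * (m : ℝ)) ≤ |(s : ℝ) - t j|
    · exact Or.inl ((hslice j _ (hx j)).1 s hs)
    · refine Or.inr ((hslice k _ (hx k)).1 s ?_)
      have h1 := ht j k hjk
      have h2 := abs_sub_le (t j : ℝ) s (t k)
      rw [abs_sub_comm (t j : ℝ) s] at h2
      have h3 : 1 / (m : ℝ) = 1 / (2 * m) + 1 / (2 * m) := by field_simp; norm_num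
      linarith
  -- With `mρ = 1` the squared norm is at most `2m + 2 ≤ 4m`.
  have hfirst : dNorm (D 0) (∑ j, (x j 0).toFun) ≤ 2 * Real.sqrt m := by
    refine le_of_sq_le_sq ?_ (by positivity)
    have h := dNorm_sum_sq_le (D 0) (x := fun j => (x j 0).toFun) (by positivity)
      (fun j => (lp.norm_apply_le_norm two_ne_zero (x j) 0).trans
        (mem_closedBall_zero_iff.1 (hx j).1)) hsmall
    rw [mul_one_div_cancel hm0.ne'] at h
    rw [mul_pow, Real.sq_sqrt hm0.le]
    linarith
  have hsplit : ∑ j, (1 / (m : ℝ)) • x j =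
      (1 / (m : ℝ)) • (lp.single 2 0 (∑ j, x j 0) + ∑ j, (x j - lp.single 2 0 (x j 0))) := by
    rw [Finset.sum_sub_distrib, ← Finset.smul_sum]
    congr 1
    have : lp.single 2 0 (∑ j, x j 0) =
        ∑ j, (lp.single 2 0 (x j 0) : lp (fun i => XSpace (D i)) 2) :=
      map_sum (lp.singleAddMonoidHom 2 0) _ _
    rw [this, add_sub_cancel]
  have hrest : ‖∑ j, (x j - lp.single 2 0 (x j 0))‖ ≤ 1 := by
    refine (norm_sum_le_of_le _ fun j _ => (hslice j _ (hx j)).2).trans_eq ?_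
    simp [hm0.ne']
  have hsqrt : 1 ≤ Real.sqrt m := Real.one_le_sqrt.2 hm1
  have hsum : ‖(lp.single 2 0 (∑ j, x j 0) : lp (fun i => XSpace (D i)) 2)‖ ≤ 2 * Real.sqrt m := by
    rw [lp.norm_single (by norm_num)]
    exact hfirst
  rw [hsplit, norm_smul, Real.norm_of_nonneg (by positivity), one_div, inv_mul_le_iff₀ hm0]
  have e : (m : ℝ) * (3 / Real.sqrt m) = 3 * Real.sqrt m := by
    rw [mul_div_assoc', div_eq_iff (by positivity), mul_assoc, Real.mul_self_sqrt hm0.le, mul_comm]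
  rw [e]
  refine (norm_add_le _ _).trans ?_
  linarith

theorem exists_convexCombOfSlices_diam_lt (D : ℕ → NbhdBase) {r : ℝ} (hr : 0 < r) :
    ∃ C : Set (lp (fun i => XSpace (D i)) 2), IsConvexCombOfSlices C ∧ Metric.diam C < r := by
  obtain ⟨m, hm⟩ := exists_nat_gt (max 0 ((6 / r) ^ 2))
  have hm0 : (0 : ℝ) < m := (le_max_left _ _).trans_lt hm
  have hms : 6 / r < Real.sqrt m := Real.lt_sqrt_of_sq_lt ((le_max_right _ _).trans_lt hm)
  obtain ⟨C, hC, hnorm⟩ := exists_convexCombOfSlices_norm_le D (m := m) (by exact_mod_cast hm0)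
  refine ⟨C, hC, (Metric.diam_le_of_forall_dist_le (C := 6 / Real.sqrt m) (by positivity)
    fun y hy z hz => ?_).trans_lt ?_⟩
  · rw [dist_eq_norm]
    refine (norm_sub_le y z).trans ?_
    have h1 := hnorm y hy
    have h2 := hnorm z hz
    have e : 6 / Real.sqrt m = 3 / Real.sqrt m + 3 / Real.sqrt m := by ring
    linarith
  · rw [div_lt_comm₀ (by positivity) hr]
    exact hms

theorem mainTheorem2 (ε : ℕ → ℝ) (hpos : ∀ n, 0 < ε n) (hanti : StrictAnti ε)
    (hlim : Tendsto ε atTop (𝓝 0)) :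
    IsMLUR (L2SumXSpace ε hpos hlim) ∧
    HasD2P (L2SumXSpace ε hpos hlim) ∧
    HasLD2PPlus (L2SumXSpace ε hpos hlim) ∧
    ∀ r : ℝ, 0 < r → ∃ C : Set (L2SumXSpace ε hpos hlim),
      IsConvexCombOfSlices C ∧ Metric.diam C < r := by
  have := nontrivial_lp (dyadicBase ε hpos hlim)
  have hfar := hasFarWeakApprox_lp (dyadicBase ε hpos hlim)
  exact ⟨(HasStrongMidpoints.lp_two fun i => XSpace.hasStrongMidpoints _).isMLUR, hfar.hasD2P,
    hfar.hasLD2PPlus, fun r hr => exists_convexCombOfSlices_diam_lt _ hr⟩
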